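/- Let $R$ and $S$ be associative rings with identity; let $\operatorname{Mod} R$ and $\operatorname{Mod} S$ be their categories of left modules. Let ${}_RC_S$ be a semidualizing $(R,S)$-bimodule, that is: ${}_RC$ and $C_S$ each have a resolution by finitely generated projective modules (over $R$, respectively $S^{op}$); the homothety maps $R\to \operatorname{Hom}_{S^{op}}(C,C)$ and $S\to\operatorname{Hom}_R(C,C)$ are isomorphisms; and $\operatorname{Ext}^{i}_R(C,C)=0=\operatorname{Ext}^{i}_{S^{op}}(C,C)$ for all $i\geq 1$. Write $M_*=\operatorname{Hom}_R(C,M)$ for $M\in\operatorname{Mod} R$, a left $S$-module via $(sf)(c)=f(cs)$. The Auslander class $\mathcal{A}_C(S)$ consists of all $A\in\operatorname{Mod} S$ such that $\operatorname{Tor}^S_i(C,A)=0$ and $\operatorname{Ext}_R^i(C,C\otimes_SA)=0$ for all $i\geq1$ and such that $\mu_A:A\to (C\otimes_SA)_*$, $\mu_A(a)(c)=c\otimes a$, is an isomorphism. The Bass class $\mathcal{B}_C(R)$ consists of all $M\in\operatorname{Mod} R$ such that $\operatorname{Ext}_R^i(C,M)=0$ and $\operatorname{Tor}^S_i(C,M_*)=0$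 for all $i\geq1$ and such that $\theta_M:C\otimes_SM_*\to M$, $\theta_M(c\otimes f)=f(c)$, is an isomorphism. For a class $\mathscr{X}$ of modules, a homomorphism $f:X\to Y$ is an $\mathscr{X}$-cover of $Y$ if $X\in\mathscr{X}$, every homomorphism $X'\to Y$ with $X'\in\mathscr{X}$ factors through $f$, and every endomorphism $h$ of $X$ with $fh=f$ is an automorphism. Let $M\in\operatorname{Mod} R$ and let $g:A\to M_*$ be an $\mathcal{A}_C(S)$-cover of $M_*$ in $\operatorname{Mod} S$. Then $$\theta_M\circ(1_C\otimes g):C\otimes_SA\to M$$ is a $\mathcal{B}_C(R)$-cover of $M$ in $\operatorname{Mod} R$. -/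

import Mathlib

open CategoryTheory MulOpposite
open scoped TensorProduct

universe u

/-! ### Covers in a category of modules -/

section Covers

variable {R : Type u} [Ring R]

/-- `f : X ⟶ Y` is an `𝒳`-precover of `Y`: `X` lies in the class `𝒳`, and for every `X'` in `𝒳`
the map `Hom(X', f) : Hom(X', X) → Hom(X', Y)` is surjective. -/
def IsPrecover (𝒳 : ObjectProperty (ModuleCat.{u} R)) {X Y : ModuleCat.{u} R} (f : X ⟶ Y) : Prop :=
  𝒳 X ∧ ∀ X' : ModuleCat.{u} R, 𝒳 X' → Function.Surjective (fun h : X' ⟶ X => h ≫ f)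

/-- `f : X ⟶ Y` is right minimal: every endomorphism `h` of `X` with `f ∘ h = f`
is an automorphism. -/
def IsRightMinimal {X Y : ModuleCat.{u} R} (f : X ⟶ Y) : Prop :=
  ∀ h : X ⟶ X, h ≫ f = f → IsIso h

/-- An `𝒳`-cover is a right minimal `𝒳`-precover. -/
def IsCover (𝒳 : ObjectProperty (ModuleCat.{u} R)) {X Y : ModuleCat.{u} R} (f : X ⟶ Y) : Prop :=
  IsPrecover 𝒳 f ∧ IsRightMinimal f

end Covers

/-! ### The group `Hom_R(C, M)` -/

section BimodHom

/-- The abelian group `Hom_R(C, M)`. It is a type synonym (indexed by `S`) that will carry only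
the left `S`-module structure coming from a right action of `S` on `C`. -/
@[nolint unusedArguments]
def BimodHom (R _S C M : Type u) [Ring R] [AddCommGroup C] [Module R C] [AddCommGroup M]
    [Module R M] : Type u :=
  C →ₗ[R] M

variable {R S C M : Type u} [Ring R] [AddCommGroup C] [Module R C] [AddCommGroup M] [Module R M]

instance : AddCommGroup (BimodHom R S C M) := inferInstanceAs (AddCommGroup (C →ₗ[R] M))

instance : FunLike (BimodHom R S C M) C M := inferInstanceAs (FunLike (C →ₗ[R] M) C M)

instance : LinearMapClass (BimodHom R S C M) R C M :=
  inferInstanceAs (LinearMapClass (C →ₗ[R] M) R C M)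

@[ext]
theorem BimodHom.ext {f f' : BimodHom R S C M} (h : ∀ c, f c = f' c) : f = f' :=
  LinearMap.ext h

@[simp]
theorem BimodHom.add_apply (f f' : BimodHom R S C M) (c : C) : (f + f') c = f c + f' c := rfl

@[simp]
theorem BimodHom.zero_apply (c : C) : (0 : BimodHom R S C M) c = 0 := rfl

end BimodHom

/-! ### Tensor product and Hom with a bimodule

An `(R, S)`-bimodule is an abelian group `C` with commuting actions of `R` and of `Sᵐᵒᵖ`;
the right action is `c · s = op s • c`. Right `S`-modules are left `Sᵐᵒᵖ`-modules. -/

section Bimodule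

variable (R S : Type u) [Ring R] [Ring S]
variable (C : Type u) [AddCommGroup C] [Module R C] [Module Sᵐᵒᵖ C] [SMulCommClass R Sᵐᵒᵖ C]

section Tensor

variable (A : Type u) [AddCommGroup A] [Module S A]

/-- The additive subgroup of `C ⊗[ℤ] A` generated by the elements `c · s ⊗ a - c ⊗ s a`;
it is stable under the left action of `R`. -/
def balancedRelations : Submodule R (C ⊗[ℤ] A) :=
  { AddSubgroup.closure
      {t : C ⊗[ℤ] A | ∃ (c : C) (s : S) (a : A), t = (op s • c) ⊗ₜ[ℤ] a - c ⊗ₜ[ℤ] (s • a)} with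
    smul_mem' := by
      intro r t ht
      change t ∈ AddSubgroup.closure _ at ht
      change r • t ∈ AddSubgroup.closure _
      induction ht using AddSubgroup.closure_induction with
      | mem x hx =>
        obtain ⟨c, s, a, rfl⟩ := hx
        refine AddSubgroup.subset_closure ⟨r • c, s, a, ?_⟩
        rw [smul_sub, TensorProduct.smul_tmul', TensorProduct.smul_tmul', smul_comm]
      | zero => rw [smul_zero]; exact zero_mem _
      | add x y _ _ hx hy => rw [smul_add]; exact add_mem hx hy
      | neg x _ hx => rw [smul_neg]; exact neg_mem hx }

/-- The left `R`-module `C ⊗_S A`, with `r (c ⊗ a) = (r c) ⊗ a`. -/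
abbrev BimodTensor : Type u := (C ⊗[ℤ] A) ⧸ balancedRelations R S C A

variable {C A}

/-- The pure tensor `c ⊗ a` in `C ⊗_S A`. -/
def bimodTmul (c : C) (a : A) : BimodTensor R S C A :=
  (balancedRelations R S C A).mkQ (c ⊗ₜ[ℤ] a)

theorem bimodTmul_smul (c : C) (s : S) (a : A) :
    bimodTmul R S (op s • c) a = bimodTmul R S c (s • a) :=
  (Submodule.Quotient.eq _).2 (AddSubgroup.subset_closure ⟨c, s, a, rfl⟩)

variable {R S}

/-- An `R`-linear map that respects the defining relations vanishes on their span. -/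
theorem balancedRelations_le_ker {N : Type u} [AddCommGroup N] [Module R N]
    (φ : C ⊗[ℤ] A →ₗ[R] N)
    (h : ∀ (c : C) (s : S) (a : A), φ ((op s • c) ⊗ₜ[ℤ] a) = φ (c ⊗ₜ[ℤ] (s • a))) :
    balancedRelations R S C A ≤ LinearMap.ker φ := by
  intro t ht
  change t ∈ AddSubgroup.closure _ at ht
  have hle : AddSubgroup.closure
      {t : C ⊗[ℤ] A | ∃ (c : C) (s : S) (a : A), t = (op s • c) ⊗ₜ[ℤ] a - c ⊗ₜ[ℤ] (s • a)} ≤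
      φ.toAddMonoidHom.ker := by
    rw [AddSubgroup.closure_le]
    rintro _ ⟨c, s, a, rfl⟩
    change φ _ = 0
    rw [map_sub, h, sub_self]
  exact hle ht

variable (R S)

theorem bimodTensor_hom_ext {N : Type u} [AddCommGroup N] [Module R N]
    {φ ψ : BimodTensor R S C A →ₗ[R] N}
    (h : ∀ (c : C) (a : A), φ (bimodTmul R S c a) = ψ (bimodTmul R S c a)) : φ = ψ := by
  refine Submodule.linearMap_qext _ (LinearMap.ext fun t => ?_)
  induction t using TensorProduct.induction_on with
  | zero => simp
  | tmul c a => exact h c a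
  | add x y hx hy => rw [map_add, map_add, hx, hy]

variable (C)

/-- `1_C ⊗ g : C ⊗_S A → C ⊗_S A'` for an `S`-linear map `g : A → A'`. -/
def bimodTensorMap {A' : Type u} [AddCommGroup A'] [Module S A'] (g : A →ₗ[S] A') :
    BimodTensor R S C A →ₗ[R] BimodTensor R S C A' :=
  (balancedRelations R S C A).liftQ
    ((balancedRelations R S C A').mkQ ∘ₗ
      TensorProduct.AlgebraTensorModule.lTensor R C g.toAddMonoidHom.toIntLinearMap)
    (balancedRelations_le_ker _ fun c s a => by
      simpa [bimodTmul] using bimodTmul_smul R S c s (g a))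

@[simp]
theorem bimodTensorMap_tmul {A' : Type u} [AddCommGroup A'] [Module S A'] (g : A →ₗ[S] A')
    (c : C) (a : A) :
    bimodTensorMap R S C g (bimodTmul R S c a) = bimodTmul R S c (g a) := rfl

end Tensor

section Hom

/-- The right multiplication `c ↦ c · s`, as an `R`-linear map. -/
def rightMul (s : S) : C →ₗ[R] C where
  toFun c := op s • c
  map_add' := smul_add _
  map_smul' r c := (smul_comm r (op s) c).symm

/-- The left multiplication `c ↦ r c`, as a map of right `S`-modules. -/
def leftMul (r : R) : C →ₗ[Sᵐᵒᵖ] C where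
  toFun c := r • c
  map_add' := smul_add _
  map_smul' s c := smul_comm r s c

variable {R S C} {M : Type u} [AddCommGroup M] [Module R M]

/-- `(s f)(c) = f (c · s)`. -/
instance : SMul S (BimodHom R S C M) where
  smul s f := LinearMap.comp (show C →ₗ[R] M from f) (rightMul R S C s)

@[simp]
theorem BimodHom.smul_apply (s : S) (f : BimodHom R S C M) (c : C) :
    (s • f) c = f (op s • c) := rfl

instance : Module S (BimodHom R S C M) where
  one_smul f := by ext c; simp
  mul_smul s t f := by ext c; simp [mul_smul]
  smul_zero s := by ext c; simp
  smul_add s f f' := by ext c; simp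
  add_smul s t f := by ext c; simp [add_smul]
  zero_smul f := by ext c; simp

variable (R S C)

/-- `f_* : Hom_R(C, M) → Hom_R(C, M')`, `φ ↦ f ∘ φ`. -/
def bimodHomMap {M M' : Type u} [AddCommGroup M] [Module R M] [AddCommGroup M'] [Module R M']
    (f : M →ₗ[R] M') : BimodHom R S C M →ₗ[S] BimodHom R S C M' where
  toFun φ := LinearMap.comp f (show C →ₗ[R] M from φ)
  map_add' φ ψ := BimodHom.ext fun c => map_add f (φ c) (ψ c)
  map_smul' _ _ := rfl

@[simp]
theorem bimodHomMap_apply {M M' : Type u} [AddCommGroup M] [Module R M] [AddCommGroup M']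
    [Module R M'] (f : M →ₗ[R] M') (φ : BimodHom R S C M) (c : C) :
    bimodHomMap R S C f φ c = f (φ c) := rfl

end Hom

/-- The functor `C ⊗_S - : Mod S ⥤ Mod R`. -/
def tensorFunctor : ModuleCat.{u} S ⥤ ModuleCat.{u} R where
  obj A := ModuleCat.of R (BimodTensor R S C A)
  map g := ModuleCat.ofHom (bimodTensorMap R S C g.hom)
  map_id A := by
    ext1
    exact bimodTensor_hom_ext R S fun c a => rfl
  map_comp f g := by
    ext1
    exact bimodTensor_hom_ext R S fun c a => rfl

instance : (tensorFunctor R S C).Additive where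
  map_add {A A' f g} := by
    ext1
    refine bimodTensor_hom_ext R S fun c a => ?_
    change (balancedRelations R S C A').mkQ (c ⊗ₜ[ℤ] (f.hom a + g.hom a)) =
      (balancedRelations R S C A').mkQ (c ⊗ₜ[ℤ] f.hom a) +
        (balancedRelations R S C A').mkQ (c ⊗ₜ[ℤ] g.hom a)
    rw [TensorProduct.tmul_add, map_add]

/-- The functor `(-)_* = Hom_R(C, -) : Mod R ⥤ Mod S`. -/
def homFunctor : ModuleCat.{u} R ⥤ ModuleCat.{u} S where
  obj M := ModuleCat.of S (BimodHom R S C M)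
  map f := ModuleCat.ofHom (bimodHomMap R S C f.hom)
  map_id _ := rfl
  map_comp _ _ := rfl

/-- The valuation map `θ_M : C ⊗_S Hom_R(C, M) → M`, `c ⊗ f ↦ f c`. -/
def thetaMap (M : ModuleCat.{u} R) :
    (tensorFunctor R S C).obj ((homFunctor R S C).obj M) ⟶ M :=
  ModuleCat.ofHom <|
    (balancedRelations R S C (BimodHom R S C M)).liftQ
      (TensorProduct.AlgebraTensorModule.lift
        { toFun := fun c =>
            { toFun := fun f : BimodHom R S C M => f c
              map_add' := fun _ _ => rfl
              map_smul' := fun n f =>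
                map_zsmul (⟨⟨fun f : BimodHom R S C M => f c, rfl⟩, fun _ _ => rfl⟩ :
                  BimodHom R S C M →+ M) n f }
          map_add' := fun c c' => LinearMap.ext fun f => map_add f c c'
          map_smul' := fun r c => LinearMap.ext fun f => map_smul f r c })
      (balancedRelations_le_ker _ fun _ _ _ => rfl)

/-- The defining formula of `θ_M`. -/
theorem thetaMap_tmul (M : ModuleCat.{u} R) (c : C) (f : BimodHom R S C M) :
    (thetaMap R S C M).hom (bimodTmul R S c f) = f c := rfl

/-- The valuation map `μ_A : A → Hom_R(C, C ⊗_S A)`, `a ↦ (c ↦ c ⊗ a)`. -/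
def muMap (A : ModuleCat.{u} S) :
    A ⟶ (homFunctor R S C).obj ((tensorFunctor R S C).obj A) :=
  ModuleCat.ofHom
    { toFun := fun a =>
        (show C →ₗ[R] BimodTensor R S C A from
          { toFun := fun c => bimodTmul R S c a
            map_add' := fun c c' => by
              simp only [bimodTmul, TensorProduct.add_tmul, map_add]
            map_smul' := fun _ _ => rfl })
      map_add' := fun a a' => BimodHom.ext fun c => by
        change (balancedRelations R S C A).mkQ (c ⊗ₜ[ℤ] (a + a')) =
          (balancedRelations R S C A).mkQ (c ⊗ₜ[ℤ] a) +
            (balancedRelations R S C A).mkQ (c ⊗ₜ[ℤ] a')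
        rw [TensorProduct.tmul_add, map_add]
      map_smul' := fun s a => BimodHom.ext fun c => (bimodTmul_smul R S c s a).symm }

/-- The defining formula of `μ_A`. -/
theorem muMap_apply (A : ModuleCat.{u} S) (a : A) (c : C) :
    (show BimodHom R S C (BimodTensor R S C A) from (muMap R S C A).hom a) c =
      bimodTmul R S c a := rfl

/-- `Tor_n^S(C, A) = 0`, where `Tor_n^S(C, -)` is the `n`-th left derived functor of `C ⊗_S -`. -/
def TorVanishes (n : ℕ) (A : ModuleCat.{u} S) : Prop :=
  Limits.IsZero (((tensorFunctor R S C).leftDerived n).obj A)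

/-! ### Semidualizing bimodules, Auslander and Bass classes -/

/-- The `(R, S)`-bimodule `C` is semidualizing. -/
structure IsSemidualizing : Prop where
  /-- `_R C` has a resolution by finitely generated projective `R`-modules. -/
  left_resolution : ∃ P : ProjectiveResolution (ModuleCat.of R C),
    ∀ n, Module.Finite R (P.complex.X n)
  /-- `C_S` has a resolution by finitely generated projective right `S`-modules. -/
  right_resolution : ∃ P : ProjectiveResolution (ModuleCat.of Sᵐᵒᵖ C),
    ∀ n, Module.Finite Sᵐᵒᵖ (P.complex.X n)
  /-- The homothety map `R → Hom_{Sᵒᵖ}(C, C)`, `r ↦ (c ↦ r c)`, is an isomorphism. -/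
  left_homothety : Function.Bijective (leftMul R S C)
  /-- The homothety map `S → Hom_R(C, C)`, `s ↦ (c ↦ c s)`, is an isomorphism. -/
  right_homothety : Function.Bijective (rightMul R S C)
  /-- `Ext_R^n(C, C) = 0` for `n ≥ 1`. -/
  left_ext : ∀ n : ℕ, 1 ≤ n → Subsingleton (Abelian.Ext (ModuleCat.of R C) (ModuleCat.of R C) n)
  /-- `Ext_{Sᵒᵖ}^n(C, C) = 0` for `n ≥ 1`. -/
  right_ext : ∀ n : ℕ, 1 ≤ n →
    Subsingleton (Abelian.Ext (ModuleCat.of Sᵐᵒᵖ C) (ModuleCat.of Sᵐᵒᵖ C) n)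

/-- The Auslander class `𝒜_C(S)` in `Mod S`: the `A` with `Tor_n^S(C, A) = 0` and
`Ext_R^n(C, C ⊗_S A) = 0` for all `n ≥ 1` and with `μ_A` an isomorphism. -/
def auslanderClass : ObjectProperty (ModuleCat.{u} S) := fun A =>
  (∀ n : ℕ, 1 ≤ n → TorVanishes R S C n A) ∧
  (∀ n : ℕ, 1 ≤ n →
    Subsingleton (Abelian.Ext (ModuleCat.of R C) ((tensorFunctor R S C).obj A) n)) ∧
  IsIso (muMap R S C A)

/-- The Bass class `ℬ_C(R)` in `Mod R`: the `M` with `Ext_R^n(C, M) = 0` and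
`Tor_n^S(C, Hom_R(C, M)) = 0` for all `n ≥ 1` and with `θ_M` an isomorphism. -/
def bassClass : ObjectProperty (ModuleCat.{u} R) := fun M =>
  (∀ n : ℕ, 1 ≤ n → Subsingleton (Abelian.Ext (ModuleCat.of R C) M n)) ∧
  (∀ n : ℕ, 1 ≤ n → TorVanishes R S C n ((homFunctor R S C).obj M)) ∧
  IsIso (thetaMap R S C M)

end Bimodule

/-! The pair (`C ⊗_S -`, `Hom_R(C, -)`) is an adjunction with unit `μ` and counit `θ`, and the map
in question is the adjoint transpose of `g`. The two functors exchange the Auslander and Bass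
classes: the Tor and Ext clauses trade places up to the isomorphisms `μ` and `θ`, and the triangle
identities make one of `μ`, `θ` invertible when the other is. Hence a map to `M` from a Bass module
`X ≅ C ⊗_S X_*` can be pushed to `X_* → M_*`, lifted through `g`, and tensored back. Minimality
transfers because `C ⊗_S -` is bijective on endomorphisms of an `A` with `μ_A` invertible. -/

section FoxbyEquivalence

variable (R S : Type u) [Ring R] [Ring S]
variable (C : Type u) [AddCommGroup C] [Module R C] [Module Sᵐᵒᵖ C] [SMulCommClass R Sᵐᵒᵖ C]

/-- The functor `C ⊗_S -` is left adjoint to `Hom_R(C, -)`, with unit `μ` and counit `θ`. -/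
def tensorHomAdjunction : tensorFunctor R S C ⊣ homFunctor R S C where
  unit :=
    { app := muMap R S C
      naturality := fun _ _ _ => rfl }
  counit :=
    { app := thetaMap R S C
      naturality := fun _ _ _ => by
        ext1
        exact bimodTensor_hom_ext R S fun _ _ => rfl }
  left_triangle_components _ := by
    ext1
    exact bimodTensor_hom_ext R S fun _ _ => rfl
  right_triangle_components _ := rfl

variable {R S C}

/-- Vanishing of `Ext(X, -)` is invariant under isomorphism. -/
theorem subsingleton_ext_of_iso {X Y Y' : ModuleCat.{u} R} (e : Y ≅ Y') {n : ℕ}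
    (h : Subsingleton (Abelian.Ext X Y n)) : Subsingleton (Abelian.Ext X Y' n) :=
  @Equiv.subsingleton _ _
    ((Abelian.extFunctorObj X n).mapIso e).addCommGroupIsoToAddEquiv.symm.toEquiv h

/-- Vanishing of `Tor_n^S(C, -)` is invariant under isomorphism. -/
theorem TorVanishes.of_iso {A A' : ModuleCat.{u} S} (e : A ≅ A') {n : ℕ}
    (h : TorVanishes R S C n A) : TorVanishes R S C n A' :=
  Limits.IsZero.of_iso h (((tensorFunctor R S C).leftDerived n).mapIso e.symm)

/-- If `μ_A` is an isomorphism, then so is `θ_{C ⊗_S A}`. -/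
theorem isIso_thetaMap_tensor {A : ModuleCat.{u} S} (h : IsIso (muMap R S C A)) :
    IsIso (thetaMap R S C ((tensorFunctor R S C).obj A)) := by
  have t : (tensorFunctor R S C).map (muMap R S C A) ≫
      thetaMap R S C ((tensorFunctor R S C).obj A) = 𝟙 _ :=
    (tensorHomAdjunction R S C).left_triangle_components A
  -- The triangle identity exhibits `θ` as the inverse of the isomorphism `C ⊗ μ_A`.
  rw [← IsIso.inv_eq_of_hom_inv_id t]
  infer_instance

/-- If `θ_X` is an isomorphism, then so is `μ_{Hom_R(C, X)}`. -/
theorem isIso_muMap_hom {X : ModuleCat.{u} R} (h : IsIso (thetaMap R S C X)) :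
    IsIso (muMap R S C ((homFunctor R S C).obj X)) := by
  have t : muMap R S C ((homFunctor R S C).obj X) ≫
      (homFunctor R S C).map (thetaMap R S C X) = 𝟙 _ :=
    (tensorHomAdjunction R S C).right_triangle_components X
  rw [← IsIso.inv_eq_of_inv_hom_id t]
  infer_instance

/-- `C ⊗_S -` maps the Auslander class to the Bass class. -/
theorem bassClass_tensor {A : ModuleCat.{u} S} (hA : auslanderClass R S C A) :
    bassClass R S C ((tensorFunctor R S C).obj A) := by
  obtain ⟨tor, ext, iso⟩ := hA
  -- The Ext clauses coincide; the Tor clause now concerns `(C ⊗_S A)_*`, which is `A` up to `μ_A`.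
  exact ⟨ext, fun n hn => (tor n hn).of_iso (asIso (muMap R S C A)), isIso_thetaMap_tensor iso⟩

/-- `Hom_R(C, -)` maps the Bass class to the Auslander class. -/
theorem auslanderClass_hom {X : ModuleCat.{u} R} (hX : bassClass R S C X) :
    auslanderClass R S C ((homFunctor R S C).obj X) := by
  obtain ⟨ext, tor, iso⟩ := hX
  exact ⟨tor, fun n hn => subsingleton_ext_of_iso (asIso (thetaMap R S C X)).symm (ext n hn),
    isIso_muMap_hom iso⟩

/-- If `g` is an `𝒜_C(S)`-precover, then its adjoint is a `ℬ_C(R)`-precover. -/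
theorem IsPrecover.adjoint {M : ModuleCat.{u} R} {A : ModuleCat.{u} S}
    {g : A ⟶ (homFunctor R S C).obj M} (hg : IsPrecover (auslanderClass R S C) g) :
    IsPrecover (bassClass R S C) ((tensorFunctor R S C).map g ≫ thetaMap R S C M) := by
  refine ⟨bassClass_tensor hg.1, fun X hX f => ?_⟩
  obtain ⟨k, hk⟩ := hg.2 _ (auslanderClass_hom hX) ((homFunctor R S C).map f)
  have := hX.2.2
  -- `k : X_* → A` lifts `f_*` through `g`; tensoring it and identifying `X` with `C ⊗_S X_*` lifts
  -- `f`, by naturality of `θ`.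
  refine ⟨inv (thetaMap R S C X) ≫ (tensorFunctor R S C).map k, ?_⟩
  have nat : (tensorFunctor R S C).map ((homFunctor R S C).map f) ≫ thetaMap R S C M =
      thetaMap R S C X ≫ f := (tensorHomAdjunction R S C).counit_naturality f
  dsimp only at hk ⊢
  rw [Category.assoc, ← Functor.map_comp_assoc, hk, nat, IsIso.inv_hom_id_assoc]

/-- If `μ_A` is an isomorphism and `g : A ⟶ Hom_R(C, M)` is right minimal, then so is the
adjoint of `g`. -/
theorem IsRightMinimal.adjoint {M : ModuleCat.{u} R} {A : ModuleCat.{u} S}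
    {g : A ⟶ (homFunctor R S C).obj M} (hg : IsRightMinimal g) (hA : IsIso (muMap R S C A)) :
    IsRightMinimal ((tensorFunctor R S C).map g ≫ thetaMap R S C M) := by
  intro h hh
  let adj := tensorHomAdjunction R S C
  have : IsIso (adj.unit.app A) := hA
  -- Fullness at `A`: the transpose `A → (C ⊗_S A)_*` of `h`, followed by the inverse of `μ_A`,
  -- gives `k`.
  obtain ⟨k, rfl⟩ : ∃ k : A ⟶ A, (tensorFunctor R S C).map k = h := by
    refine ⟨adj.homEquiv _ _ h ≫ inv (adj.unit.app A), (adj.homEquiv _ _).injective ?_⟩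
    rw [adj.homEquiv_unit, adj.unit_naturality, Category.assoc, IsIso.inv_hom_id,
      Category.comp_id]
  -- Transposition is injective, and the transposes of both sides agree by `hh`.
  have hk : k ≫ g = g := by
    refine (adj.homEquiv _ _).symm.injective ?_
    rw [adj.homEquiv_counit, adj.homEquiv_counit, Functor.map_comp, Category.assoc]
    exact hh
  have := hg k hk
  infer_instance

end FoxbyEquivalence

theorem proposition3p8 {R S : Type u} [Ring R] [Ring S]
    {C : Type u} [AddCommGroup C] [Module R C] [Module Sᵐᵒᵖ C] [SMulCommClass R Sᵐᵒᵖ C]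
    (hC : IsSemidualizing R S C)
    (M : ModuleCat.{u} R) (A : ModuleCat.{u} S) (g : A ⟶ (homFunctor R S C).obj M)
    (hg : IsCover (auslanderClass R S C) g) :
    IsCover (bassClass R S C) ((tensorFunctor R S C).map g ≫ thetaMap R S C M) :=
  -- Membership of `A` in the Auslander class supplies the invertibility of `μ_A` needed for
  -- minimality.
  ⟨hg.1.adjoint, hg.2.adjoint hg.1.1.2.2⟩
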